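/- **Setting.** Let $B$ be a stationary Bratteli diagram: level $0$ is a single vertex $v_0$, every level $n\ge 1$ is a copy of a finite set $V$, every vertex of level $1$ is joined to $v_0$ by at least one edge, and for all $n\ge1$ there are $F_{w,v}\in\mathbb{N}_0$ edges from the vertex $v$ of level $n$ to the vertex $w$ of level $n+1$, where the incidence matrix $F=(F_{w,v})_{w,v\in V}$ has no zero row and no zero column. Write $v\to w$ if $w$ can be reached from $v$ by a (possibly trivial) downward path. Vertices $v,w$ are in the same class if $v\to w$ and $w\to v$; for classes, $\beta\prec\alpha$ means that $\beta\ne\alpha$ and the vertices of $\alpha$ can be reached from those of $\beta$. As usual, $B$ is assumed to be telescoped so that, for every class, the corresponding diagonal block of $F$ is either zero or primitive. Let $X_B$ be the space of infinite paths starting at $v_0$, with the topology generated by the cylinder sets, and let $\mathcal R$ be the tail equivalence relation on $X_B$ (two paths are equivalent if they agree from some level on). A Borel measure is $\mathcal R$-invariant if it is preserved by every Borel automorphism $T$ of $X_B$ with $(x,Tx)\in\mathcal R$ for all $x$, and ergodic if every $\mathcal R$-saturated Borel set is null or has null complement. For a Borel measure $\mu$ on a compact zero-dimensional metrizable space $X$,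 let $\mathfrak M_\mu$ be the set of points all of whose clopen neighbourhoods have infinite measure. The measure $\mu$ is full if non-empty open sets have positive measure, and non-defective if it is full, non-atomic, $\mu(X)=\infty$ and $\mu(\mathfrak M_\mu)=0$. A measure $\mu$ that is either non-defective or a full non-atomic probability measure is called *good* if for all clopen $U,V\subseteq X$ with $\mu(U)<\mu(V)$ there is a clopen $W\subseteq V$ with $\mu(W)=\mu(U)$. Let $\mu$ be an ergodic $\mathcal R$-invariant non-atomic Borel measure on $X_B$ with $\mu(X_B)=\infty$ and $0<\mu(U)<\infty$ for at least one clopen set $U$. Let $\alpha$ be the class of vertices corresponding to $\mu$, that is, the class such that $\mu$-almost every path eventually passes only through vertices of $\alpha$. Let $B_f$ be the subdiagram of $B$ whose vertices (besides $v_0$, and on every level $n\ge1$) are those of $\alpha$ and those vertices $v$ of classes $\beta\prec\alpha$ for which all cylinder sets ending in $v$ have finite measure, and whose edges are all edges of $B$ between these vertices. Let $X_{B_f}\subseteq X_B$ be its space of infinite paths and let $\mu_f=\mu(X_{B_f})^{-1}\,\mu|_{X_{B_f}}$ be the corresponding probability measure on $X_{B_f}$. **Theorem.** The measure $\mu$,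 considered on its support $\operatorname{supp}(\mu)$, is good if and only if the probability measure $\mu_f$ on $X_{B_f}$ is good. -/

import Mathlib

open MeasureTheory Set
open scoped ENNReal

section GoodMeasures

variable {X : Type*} [TopologicalSpace X] [MeasurableSpace X]

/-- The defective set of `μ`: the points all of whose clopen neighbourhoods have infinite
measure. -/
def defectiveSet (μ : Measure X) : Set X :=
  {x | ∀ U : Set X, IsClopen U → x ∈ U → μ U = ∞}

/-- Non-defective measures: full (positive on non-empty open sets), non-atomic, infinite measures
whose defective set is null. -/
structure IsNonDefective (μ : Measure X) : Prop where
  full : ∀ U : Set X, IsOpen U → U.Nonempty → 0 < μ U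
  nonatomic : ∀ x : X, μ {x} = 0
  infinite : μ univ = ∞
  null_defectiveSet : μ (defectiveSet μ) = 0

/-- Full non-atomic probability measures. -/
structure IsFullNonatomicProbability (μ : Measure X) : Prop where
  full : ∀ U : Set X, IsOpen U → U.Nonempty → 0 < μ U
  nonatomic : ∀ x : X, μ {x} = 0
  probability : μ univ = 1

/-- A clopen set `V` is good for `μ` if for every clopen `U` with `μ U < μ V` there is a clopen
subset of `V` of the same measure as `U`. -/
def IsGoodClopen (μ : Measure X) (V : Set X) : Prop :=
  ∀ U : Set X, IsClopen U → μ U < μ V → ∃ W : Set X, IsClopen W ∧ W ⊆ V ∧ μ W = μ U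

/-- A good non-defective (infinite) measure. -/
def IsGoodInfinite (μ : Measure X) : Prop :=
  IsNonDefective μ ∧ ∀ V : Set X, IsClopen V → IsGoodClopen μ V

/-- A good probability measure. -/
def IsGoodProbability (μ : Measure X) : Prop :=
  IsFullNonatomicProbability μ ∧ ∀ V : Set X, IsClopen V → IsGoodClopen μ V

end GoodMeasures

/-- A stationary Bratteli diagram. Level `0` is the single vertex `v₀`, and every level `n ≥ 1` is a
copy of the finite set `V`. There are `hat v` edges from `v₀` to the vertex `v` of level `1`, and
`F w v` edges from the vertex `v` of level `n` to the vertex `w` of level `n + 1`, for all `n ≥ 1`;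
so `F` is the incidence matrix. Every vertex emits an edge and every vertex other than `v₀`
receives one. -/
structure StationaryBratteli (V : Type*) [Fintype V] where
  hat : V → ℕ
  F : Matrix V V ℕ
  hat_pos : ∀ v, 0 < hat v
  exists_out : ∀ v, ∃ w, 0 < F w v
  exists_in : ∀ w, ∃ v, 0 < F w v

namespace StationaryBratteli

variable {V : Type*} [Fintype V] (B : StationaryBratteli V)

/-- The edges between levels `0` and `1`. -/
def TopEdge : Type _ := Σ v : V, Fin (B.hat v)

/-- The edges between two consecutive levels `n` and `n + 1`, `n ≥ 1`: a pair (range, source)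
together with a label. -/
def Edge : Type _ := Σ p : V × V, Fin (B.F p.1 p.2)

instance : TopologicalSpace B.TopEdge := ⊥

instance : TopologicalSpace B.Edge := ⊥

variable {B} in
/-- The range, at level `1`, of an edge between levels `0` and `1`. -/
def TopEdge.range (e : B.TopEdge) : V := e.1

variable {B} in
/-- The vertex at which an edge starts (the one on the upper level). -/
def Edge.source (e : B.Edge) : V := e.1.2

variable {B} in
/-- The vertex at which an edge ends (the one on the next level). -/
def Edge.range (e : B.Edge) : V := e.1.1

/-- The path space `X_B`: all infinite paths starting at `v₀`. The edge number `n` of the sequence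
leads from level `n + 1` to level `n + 2`. -/
def PathSpace : Type _ :=
  {x : B.TopEdge × (ℕ → B.Edge) //
    x.1.range = (x.2 0).source ∧ ∀ n, (x.2 n).range = (x.2 (n + 1)).source}

/-- The product topology; it is generated by the cylinder sets. -/
instance : TopologicalSpace B.PathSpace := instTopologicalSpaceSubtype

instance : MeasurableSpace B.PathSpace := borel _

instance : BorelSpace B.PathSpace := ⟨rfl⟩

namespace PathSpace

variable {B}

/-- The edge of `x` between levels `0` and `1`. -/
def top (x : B.PathSpace) : B.TopEdge := x.1.1

/-- The edge of `x` between levels `n + 1` and `n + 2`. -/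
def edge (x : B.PathSpace) (n : ℕ) : B.Edge := x.1.2 n

/-- The vertex of `x` at level `n + 1`. -/
def vertex (x : B.PathSpace) (n : ℕ) : V := (x.edge n).source

/-- The cylinder set of all paths with the same beginning as `x` down to level `n + 1`; it ends in
the vertex `x.vertex n` of that level. -/
def cylinder (x : B.PathSpace) (n : ℕ) : Set B.PathSpace :=
  {y | y.top = x.top ∧ ∀ k < n, y.edge k = x.edge k}

/-- The tail (cofinal) equivalence relation `ℛ`. -/
def TailRel (x y : B.PathSpace) : Prop := ∃ N, ∀ n ≥ N, x.edge n = y.edge n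

end PathSpace

open PathSpace

/-- `w` can be reached from `v` by a (possibly trivial) path going down the diagram. -/
def Reaches (v w : V) : Prop := Relation.ReflTransGen (fun a b => 0 < B.F b a) v w

/-- The class of the vertex `a`: the vertices that reach `a` and are reached from it. -/
def vertexClass (a : V) : Set V := {v | B.Reaches a v ∧ B.Reaches v a}

open Classical in
/-- The usual normalization of a stationary diagram: every diagonal block of the Frobenius normal
form of the incidence matrix, that is, its restriction to a vertex class, is zero or primitive. -/
def HasPrimitiveBlocks : Prop :=
  ∀ a : V,
    let M : Matrix (B.vertexClass a) (B.vertexClass a) ℝ := fun v w => (B.F v w : ℝ)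
    M = 0 ∨ M.IsPrimitive

/-- The infinite paths that eventually pass only through vertices of the class of `a`. -/
def eventualPaths (a : V) : Set B.PathSpace :=
  {x | ∃ N, ∀ n ≥ N, x.vertex n ∈ B.vertexClass a}

/-- The infinite paths of the subdiagram of `B` whose vertices are `v₀` and those in `S` (on every
level `n ≥ 1`) and whose edges are all edges of `B` between these vertices. -/
def subdiagramPaths (S : Set V) : Set B.PathSpace := {x | ∀ n, x.vertex n ∈ S}

variable {B}

/-- `ℛ`-invariance: `μ` is preserved by every Borel automorphism of the path space that moves each
path inside its tail equivalence class. -/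
def IsTailInvariant (μ : Measure B.PathSpace) : Prop :=
  ∀ T : B.PathSpace ≃ᵐ B.PathSpace, (∀ x, TailRel x (T x)) → MeasurePreserving T μ μ

/-- Ergodicity: every `ℛ`-saturated Borel set is null or conull. -/
def IsTailErgodic (μ : Measure B.PathSpace) : Prop :=
  ∀ E : Set B.PathSpace, MeasurableSet E → (∀ x y, TailRel x y → (x ∈ E ↔ y ∈ E)) →
    μ E = 0 ∨ μ Eᶜ = 0

/-- The class `α` of vertices corresponding to `μ`: the class such that `μ`-almost every path
eventually passes only through its vertices. -/
def supportingClass (μ : Measure B.PathSpace) : Set V := {a | μ (B.eventualPaths a)ᶜ = 0}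

/-- The vertices of `B_f`: those of the class `α` corresponding to `μ` and those of the classes
`β ≺ α` (from which `α` can be reached) such that all cylinder sets ending in them have finite
measure. -/
def finiteVertices (μ : Measure B.PathSpace) : Set V :=
  {v | v ∈ supportingClass μ ∨
    ((∃ a ∈ supportingClass μ, B.Reaches v a) ∧
      ∀ (x : B.PathSpace) (n : ℕ), x.vertex n = v → μ (x.cylinder n) < ∞)}

/-- The path space `X_{B_f}` of the subdiagram `B_f`. -/
def finitePaths (μ : Measure B.PathSpace) : Set B.PathSpace :=
  B.subdiagramPaths (finiteVertices μ)

/-- The measure `μ_f` on the path space of `B_f`: the restriction of `μ`, normalized to be a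
probability measure. -/
noncomputable def finiteMeasure (μ : Measure B.PathSpace) : Measure (finitePaths μ) :=
  (μ (finitePaths μ))⁻¹ • μ.comap Subtype.val

/-- The measure `μ` considered on its (topological) support. -/
noncomputable def measureOnSupport (μ : Measure B.PathSpace) : Measure μ.support :=
  μ.comap Subtype.val

end StationaryBratteli

namespace StationaryBratteli

variable {V : Type*} [Fintype V] {B : StationaryBratteli V}

/-! Let `T` be the clopen set of paths whose vertex at level 1 lies in `finiteVertices μ`. Both
goodness conditions are statements about clopen subsets of the whole path space: goodness on the
support is `IsGoodOn μ univ`, and goodness of `μ_f` is `IsGoodOn μ T`. Indeed clopen subsets of a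
closed set are traces of clopen sets, and `T` differs from `X_{B_f}` by a null set, since almost
every path eventually runs in `α` and a vertex below a finite one that still reaches `α` is finite
(`measure_diff_finitePaths`). So one implication is restriction to `T`.

For the converse, invariance makes the measure of a cylinder depend only on its last vertex and
level. A clopen set of finite measure splits into null cylinders and cylinders that a
tail-preserving homeomorphism moves into `T` (`isUnionOfCopies`). This needs finiteness of a vertex
to be independent of the level (`levelMeasure_lt_top_iff`), which follows from comparing adjacent
levels inside `α`, where the block of `F` is primitive, and a pigeonhole argument giving an end
vertex in common with a path inside `T`. With such decompositions, goodness on `T` allows pieces to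
be fitted one after another into any clopen set of finite measure that is large enough. A clopen set
of infinite measure is exhausted from inside by clopen sets of finite measure
(`exists_isClopen_subset_lt`). -/

instance : DiscreteTopology B.TopEdge := ⟨rfl⟩

instance : DiscreteTopology B.Edge := ⟨rfl⟩

instance : Fintype B.TopEdge := inferInstanceAs (Fintype (Σ v : V, Fin (B.hat v)))

instance : Fintype B.Edge := inferInstanceAs (Fintype (Σ p : V × V, Fin (B.F p.1 p.2)))

/-! ### Constructing, cutting and splicing paths -/

lemma exists_edge {v w : V} (h : 0 < B.F w v) : ∃ e : B.Edge, e.source = v ∧ e.range = w :=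
  ⟨⟨(w, v), ⟨0, h⟩⟩, rfl, rfl⟩

lemma Edge.reaches (e : B.Edge) : B.Reaches e.source e.range :=
  Relation.ReflTransGen.single (lt_of_le_of_lt (Nat.zero_le _) e.2.isLt)

namespace PathSpace

@[ext]
lemma ext {x y : B.PathSpace} (h₀ : x.top = y.top) (h : ∀ n, x.edge n = y.edge n) : x = y :=
  Subtype.ext (Prod.ext h₀ (funext h))

/-- The path with given edges. -/
def mk (t : B.TopEdge) (f : ℕ → B.Edge) (h₀ : t.range = (f 0).source)
    (h : ∀ n, (f n).range = (f (n + 1)).source) : B.PathSpace :=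
  ⟨(t, f), h₀, h⟩

@[simp]
lemma top_mk (t : B.TopEdge) (f : ℕ → B.Edge) (h₀ h) : (mk t f h₀ h).top = t := rfl

@[simp]
lemma edge_mk (t : B.TopEdge) (f : ℕ → B.Edge) (h₀ h) (n : ℕ) : (mk t f h₀ h).edge n = f n := rfl

lemma source_edge (x : B.PathSpace) (n : ℕ) : (x.edge n).source = x.vertex n := rfl

lemma range_edge (x : B.PathSpace) (n : ℕ) : (x.edge n).range = x.vertex (n + 1) := x.2.2 n

lemma range_top (x : B.PathSpace) : x.top.range = x.vertex 0 := x.2.1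

lemma reaches_vertex (x : B.PathSpace) {m n : ℕ} (h : m ≤ n) :
    B.Reaches (x.vertex m) (x.vertex n) := by
  induction n, h using Nat.le_induction with
  | base => exact Relation.ReflTransGen.refl
  | succ n _ ih => exact ih.trans (x.range_edge n ▸ (x.edge n).reaches)

/-- The path of which the first `n + 1` vertices are dropped; its first vertex is
`x.vertex n`. -/
def shift (n : ℕ) (x : B.PathSpace) : B.PathSpace :=
  -- Any edge from `v₀` would serve; `hat_pos` is what lets a path start at an arbitrary vertex.
  mk ⟨x.vertex n, ⟨0, B.hat_pos _⟩⟩ (fun k => x.edge (n + k)) rfl fun k => x.range_edge (n + k)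

@[simp]
lemma vertex_shift (n : ℕ) (x : B.PathSpace) (k : ℕ) : (x.shift n).vertex k = x.vertex (n + k) :=
  rfl

/-- The path that follows `x` down to its vertex number `n` and `z` from then on. -/
def splice (x z : B.PathSpace) (n : ℕ) (h : z.vertex n = x.vertex n) : B.PathSpace :=
  mk x.top (fun k => if k < n then x.edge k else z.edge k)
    (by
      rcases Nat.eq_zero_or_pos n with rfl | hn
      · simp [range_top, source_edge, h]
      · simp [hn, range_top, source_edge])
    (by
      intro k
      rcases lt_trichotomy (k + 1) n with hk | hk | hk
      · simp [hk, (Nat.lt_succ_self k).trans hk, range_edge, source_edge]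
      · subst hk
        simp [range_edge, source_edge, h]
      · have h1 : ¬ k < n := by omega
        have h2 : ¬ k + 1 < n := by omega
        simp [h1, h2, range_edge, source_edge])

variable (B) in
lemma exists_vertex_zero_eq (v : V) : ∃ x : B.PathSpace, x.vertex 0 = v := by
  choose s hs using B.exists_out
  choose e he he' using fun v => exists_edge (hs v)
  refine ⟨mk ⟨v, ⟨0, B.hat_pos v⟩⟩ (fun n => e (s^[n] v)) (he v).symm fun n => ?_, he v⟩
  rw [he', he, Function.iterate_succ_apply']

/-- A path can be continued by any edge that starts at its end. -/
lemma exists_mem_cylinder_edge_eq (x : B.PathSpace) (n : ℕ) (e : B.Edge)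
    (he : e.source = x.vertex n) : ∃ y ∈ x.cylinder n, y.edge n = e := by
  obtain ⟨z, hz⟩ := exists_vertex_zero_eq B e.range
  let f : ℕ → B.Edge := fun k =>
    if k < n then x.edge k else if k = n then e else z.edge (k - (n + 1))
  have h₀ : x.top.range = (f 0).source := ?_
  have h : ∀ k, (f k).range = (f (k + 1)).source := ?_
  · exact ⟨mk x.top f h₀ h, ⟨rfl, fun k hk => by simp [f, hk]⟩, by simp [f]⟩
  · intro k
    rcases lt_trichotomy (k + 1) n with hk | hk | hk
    · simp [f, hk, (Nat.lt_succ_self k).trans hk, range_edge, source_edge]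
    · subst hk
      simp [f, range_edge, he]
    · rcases (Nat.lt_succ_iff.1 hk).eq_or_lt with rfl | hk'
      · simp [f, source_edge, hz]
      · have h1 : ¬ k < n := by omega
        have h2 : ¬ k + 1 < n := by omega
        have h3 : k ≠ n := by omega
        have h4 : k + 1 ≠ n := by omega
        have h5 : k + 1 - (n + 1) = k - (n + 1) + 1 := by omega
        simp only [f, h1, h2, h3, h4, if_false, h5, range_edge, source_edge]
  · rcases Nat.eq_zero_or_pos n with rfl | hn
    · simp [f, range_top, he]
    · simp [f, hn, range_top, source_edge]

lemma mem_cylinder_self (x : B.PathSpace) (n : ℕ) : x ∈ x.cylinder n := ⟨rfl, fun _ _ => rfl⟩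

lemma cylinder_eq_of_mem {x y : B.PathSpace} {n : ℕ} (h : y ∈ x.cylinder n) :
    y.cylinder n = x.cylinder n := by
  ext z
  exact ⟨fun hz => ⟨hz.1.trans h.1, fun k hk => (hz.2 k hk).trans (h.2 k hk)⟩,
    fun hz => ⟨hz.1.trans h.1.symm, fun k hk => (hz.2 k hk).trans (h.2 k hk).symm⟩⟩

lemma cylinder_anti (x : B.PathSpace) {m n : ℕ} (h : m ≤ n) : x.cylinder n ⊆ x.cylinder m :=
  fun _ hy => ⟨hy.1, fun k hk => hy.2 k (hk.trans_le h)⟩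

lemma vertex_eq_of_mem_cylinder {x y : B.PathSpace} {n k : ℕ} (h : y ∈ x.cylinder n)
    (hk : k ≤ n) : y.vertex k = x.vertex k := by
  cases k with
  | zero => rw [← range_top, ← range_top, h.1]
  | succ k => rw [← range_edge, ← range_edge, h.2 k hk]

lemma splice_mem_cylinder (x z : B.PathSpace) (n : ℕ) (h : z.vertex n = x.vertex n) :
    x.splice z n h ∈ x.cylinder n :=
  ⟨rfl, fun k hk => by simp [splice, hk]⟩

variable (B) in
lemma exists_vertex_eq (v : V) (n : ℕ) : ∃ x : B.PathSpace, x.vertex n = v := by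
  induction n generalizing v with
  | zero => exact exists_vertex_zero_eq B v
  | succ n ih =>
    obtain ⟨u, hu⟩ := B.exists_in v
    obtain ⟨e, he, rfl⟩ := exists_edge hu
    obtain ⟨x, hx⟩ := ih u
    obtain ⟨y, -, rfl⟩ := exists_mem_cylinder_edge_eq x n e (he.trans hx.symm)
    exact ⟨y, (y.range_edge n).symm⟩

/-! ### Topology of the path space -/

lemma continuous_top : Continuous (top : B.PathSpace → B.TopEdge) :=
  continuous_fst.comp continuous_subtype_val

lemma continuous_edge (n : ℕ) : Continuous fun x : B.PathSpace => x.edge n :=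
  (continuous_apply n).comp (continuous_snd.comp continuous_subtype_val)

instance : T2Space B.PathSpace :=
  inferInstanceAs (T2Space {x : B.TopEdge × (ℕ → B.Edge) //
    x.1.range = (x.2 0).source ∧ ∀ n, (x.2 n).range = (x.2 (n + 1)).source})

instance : TotallyDisconnectedSpace B.PathSpace :=
  inferInstanceAs (TotallyDisconnectedSpace {x : B.TopEdge × (ℕ → B.Edge) //
    x.1.range = (x.2 0).source ∧ ∀ n, (x.2 n).range = (x.2 (n + 1)).source})

instance : SecondCountableTopology B.PathSpace :=
  TopologicalSpace.Subtype.secondCountableTopology _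

instance : CompactSpace B.PathSpace := by
  have h : IsClosed {x : B.TopEdge × (ℕ → B.Edge) |
      x.1.range = (x.2 0).source ∧ ∀ n, (x.2 n).range = (x.2 (n + 1)).source} := by
    rw [ofPred_and, ofPred_forall]
    refine IsClosed.inter ?_ (isClosed_iInter fun n => ?_)
    · exact (isClosed_discrete {p : B.TopEdge × B.Edge | p.1.range = p.2.source}).preimage
        (f := fun x : B.TopEdge × (ℕ → B.Edge) => (x.1, x.2 0)) (by fun_prop)
    · exact (isClosed_discrete {p : B.Edge × B.Edge | p.1.range = p.2.source}).preimage
        (f := fun x : B.TopEdge × (ℕ → B.Edge) => (x.2 n, x.2 (n + 1))) (by fun_prop)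
  exact isCompact_iff_compactSpace.1 h.isCompact

lemma isClopen_vertex_mem (n : ℕ) (A : Set V) : IsClopen {x : B.PathSpace | x.vertex n ∈ A} :=
  (isClopen_discrete {e : B.Edge | e.source ∈ A}).preimage (continuous_edge n)

lemma isClopen_edge_eq (n : ℕ) (e : B.Edge) : IsClopen {x : B.PathSpace | x.edge n = e} :=
  (isClopen_discrete {e}).preimage (continuous_edge n)

/-- The first `n + 1` edges of a path. -/
def initial (n : ℕ) (x : B.PathSpace) : B.TopEdge × (Fin n → B.Edge) := (x.top, fun i => x.edge i)

lemma continuous_initial (n : ℕ) : Continuous (initial n : B.PathSpace → _) :=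
  continuous_top.prodMk (continuous_pi fun i => continuous_edge i)

lemma mem_cylinder_iff {x y : B.PathSpace} {n : ℕ} :
    y ∈ x.cylinder n ↔ y.initial n = x.initial n := by
  simp [cylinder, initial, funext_iff, Fin.forall_iff]

lemma cylinder_eq_preimage (x : B.PathSpace) (n : ℕ) :
    x.cylinder n = initial n ⁻¹' {x.initial n} := by
  ext y
  exact mem_cylinder_iff

lemma isClopen_cylinder (x : B.PathSpace) (n : ℕ) : IsClopen (x.cylinder n) := by
  rw [cylinder_eq_preimage]
  exact (isClopen_discrete _).preimage (continuous_initial n)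

/-- The cylinders around `x` are nested compact sets with intersection `{x}`. -/
lemma exists_cylinder_subset {O : Set B.PathSpace} (hO : IsOpen O) {x : B.PathSpace}
    (hx : x ∈ O) : ∃ n, x.cylinder n ⊆ O := by
  refine exists_subset_nhds_of_isCompact (V := fun n => x.cylinder n) ?_
    (fun n => (isClopen_cylinder x n).isClosed.isCompact) ?_
  · exact directed_of_isDirected_le fun m n h => x.cylinder_anti h
  · intro y hy
    have : y = x := ext (mem_iInter.1 hy 0).1 fun n => (mem_iInter.1 hy (n + 1)).2 n n.lt_succ_self
    exact this ▸ hO.mem_nhds hx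

lemma exists_forall_cylinder_subset {U : Set B.PathSpace} (hU : IsClopen U) :
    ∃ N, ∀ x ∈ U, x.cylinder N ⊆ U := by
  refine hU.isClosed.isCompact.elim_directed_cover (fun n => {x | x.cylinder n ⊆ U})
    (fun n => isOpen_iff_forall_mem_open.2 fun x hx =>
      ⟨x.cylinder n, fun y hy => ?_, (isClopen_cylinder x n).isOpen, x.mem_cylinder_self n⟩)
    (fun x hx => mem_iUnion.2 (exists_cylinder_subset hU.isOpen hx))
    (directed_of_isDirected_le fun m n h x hx => (x.cylinder_anti h).trans hx)
  simpa [cylinder_eq_of_mem hy] using hx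

/-- An induction principle for clopen sets: a property that holds for the empty set and is
preserved by adding a disjoint cylinder down to level `N + 1` holds for every clopen set that is a
union of such cylinders. -/
lemma clopen_induction {N : ℕ} {P : Set B.PathSpace → Prop} (h₀ : P ∅)
    {U : Set B.PathSpace} (hU : ∀ x ∈ U, x.cylinder N ⊆ U)
    (h : ∀ x ∈ U, ∀ R, IsClopen R → R ⊆ U → Disjoint (x.cylinder N) R → P R →
      P (x.cylinder N ∪ R)) :
    P U := by
  classical
  -- There are only finitely many initial segments; the induction runs over the set of segments
  -- admitted so far. Segments that do not occur in `U` change nothing.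
  have key : ∀ s : Finset (B.TopEdge × (Fin N → B.Edge)), P (initial N ⁻¹' s ∩ U) := by
    intro s
    induction s using Finset.induction_on with
    | empty => simpa using h₀
    | insert p s hp ih =>
      by_cases hx : ∃ x ∈ U, x.initial N = p
      · obtain ⟨x, hxU, rfl⟩ := hx
        have hE : initial N ⁻¹' ((insert (x.initial N) s : Finset _) : Set _) ∩ U =
            x.cylinder N ∪ (initial N ⁻¹' s ∩ U) := by
          rw [Finset.coe_insert, insert_eq, preimage_union, union_inter_distrib_right,
            ← cylinder_eq_preimage, inter_eq_left.2 (hU x hxU)]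
        rw [hE]
        refine h x hxU _ ?_ inter_subset_right ?_ ih
        · have hi : IsOpen U := isOpen_iff_forall_mem_open.2 fun y hy =>
            ⟨_, hU y hy, (isClopen_cylinder y N).isOpen, y.mem_cylinder_self N⟩
          have hi' : IsOpen Uᶜ := isOpen_iff_forall_mem_open.2 fun y hy =>
            ⟨_, fun z hz hzU => hy (hU z hzU (cylinder_eq_of_mem hz ▸ y.mem_cylinder_self N)),
              (isClopen_cylinder y N).isOpen, y.mem_cylinder_self N⟩
          exact ((isClopen_discrete _).preimage (continuous_initial N)).inter
            ⟨⟨hi'⟩, hi⟩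
        · refine disjoint_left.2 fun y hy hy' => hp ?_
          rw [← mem_cylinder_iff.1 hy]
          exact hy'.1
      · convert ih using 1
        ext y
        simp only [Finset.coe_insert, mem_inter_iff, mem_preimage, mem_insert_iff, Finset.mem_coe]
        exact ⟨fun ⟨h1, h2⟩ => ⟨h1.resolve_left fun h3 => hx ⟨y, h2, h3⟩, h2⟩,
          fun ⟨h1, h2⟩ => ⟨Or.inr h1, h2⟩⟩
  simpa using key Finset.univ

/-! ### Exchanging two cylinders -/

open Classical in
/-- The map that exchanges the cylinder sets of `x` and `y` down to the vertex number `n`, by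
exchanging the beginnings of paths, and fixes all other paths. -/
noncomputable def swapFun (x y : B.PathSpace) (n : ℕ) (h : x.vertex n = y.vertex n)
    (z : B.PathSpace) : B.PathSpace :=
  if hx : z ∈ x.cylinder n then
    y.splice z n ((vertex_eq_of_mem_cylinder hx le_rfl).trans h)
  else if hy : z ∈ y.cylinder n then
    x.splice z n ((vertex_eq_of_mem_cylinder hy le_rfl).trans h.symm)
  else z

section swap

variable {x y : B.PathSpace} {n : ℕ} (h : x.vertex n = y.vertex n)

lemma edge_swapFun {z : B.PathSpace} {k : ℕ} (hk : n ≤ k) :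
    (swapFun x y n h z).edge k = z.edge k := by
  unfold swapFun
  split_ifs <;> simp [splice, hk.not_gt]

lemma swapFun_mem {z : B.PathSpace} (hz : z ∈ x.cylinder n) :
    swapFun x y n h z ∈ y.cylinder n := by
  simp only [swapFun, hz, dif_pos]
  exact splice_mem_cylinder _ _ _ _

lemma initial_swapFun_left {z : B.PathSpace} (hz : z ∈ x.cylinder n) :
    (swapFun x y n h z).initial n = y.initial n :=
  mem_cylinder_iff.1 (swapFun_mem h hz)

lemma initial_swapFun_right {z : B.PathSpace} (hz : z ∈ y.cylinder n) :
    (swapFun x y n h z).initial n = x.initial n := by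
  by_cases hx : z ∈ x.cylinder n
  · rw [initial_swapFun_left h hx, ← mem_cylinder_iff.1 hz, mem_cylinder_iff.1 hx]
  · simp only [swapFun, hx, hz, dif_pos, dif_neg, not_false_iff]
    exact mem_cylinder_iff.1 (splice_mem_cylinder _ _ _ _)

lemma swapFun_of_notMem {z : B.PathSpace} (hx : z ∉ x.cylinder n) (hy : z ∉ y.cylinder n) :
    swapFun x y n h z = z := by
  simp [swapFun, hx, hy]

lemma eq_of_initial_eq {z w : B.PathSpace} (n : ℕ) (h : z.initial n = w.initial n)
    (h' : ∀ k, n ≤ k → z.edge k = w.edge k) : z = w := by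
  have := mem_cylinder_iff.2 h
  exact ext this.1 fun k => (lt_or_ge k n).elim (this.2 k) (h' k)

lemma swapFun_swapFun (z : B.PathSpace) : swapFun x y n h (swapFun x y n h z) = z := by
  refine eq_of_initial_eq n ?_ fun k hk => by rw [edge_swapFun h hk, edge_swapFun h hk]
  by_cases hx : z ∈ x.cylinder n
  · rw [initial_swapFun_right h (swapFun_mem h hx), mem_cylinder_iff.1 hx]
  · by_cases hy : z ∈ y.cylinder n
    · rw [initial_swapFun_left h (mem_cylinder_iff.2 (initial_swapFun_right h hy)),
        mem_cylinder_iff.1 hy]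
    · rw [swapFun_of_notMem h hx hy, swapFun_of_notMem h hx hy]

lemma initial_swapFun_congr {z w : B.PathSpace} (hzw : w ∈ z.cylinder n) :
    (swapFun x y n h w).initial n = (swapFun x y n h z).initial n := by
  have hw : w.initial n = z.initial n := mem_cylinder_iff.1 hzw
  by_cases hx : z ∈ x.cylinder n
  · rw [initial_swapFun_left h hx, initial_swapFun_left h]
    rwa [mem_cylinder_iff, hw, ← mem_cylinder_iff]
  · by_cases hy : z ∈ y.cylinder n
    · rw [initial_swapFun_right h hy, initial_swapFun_right h]
      rwa [mem_cylinder_iff, hw, ← mem_cylinder_iff]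
    · rw [swapFun_of_notMem h hx hy, swapFun_of_notMem h, hw]
      · rwa [mem_cylinder_iff, hw, ← mem_cylinder_iff]
      · rwa [mem_cylinder_iff, hw, ← mem_cylinder_iff]

lemma continuous_swapFun : Continuous (swapFun x y n h) := by
  -- Before `n` the new edges depend only on the first segment of the path, and from `n` on the
  -- edges are unchanged, so depth `max n m` suffices.
  have loc : ∀ (z : B.PathSpace) (m : ℕ), ∀ w ∈ z.cylinder (max n m),
      swapFun x y n h w ∈ (swapFun x y n h z).cylinder (max n m) := by
    intro z m w hw
    have h1 := mem_cylinder_iff.2 (initial_swapFun_congr h (z.cylinder_anti (le_max_left n m) hw))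
    refine ⟨h1.1, fun k hk => ?_⟩
    rcases lt_or_ge k n with hkn | hkn
    · exact h1.2 k hkn
    · rw [edge_swapFun h hkn, edge_swapFun h hkn, hw.2 k hk]
  refine continuous_def.2 fun O hO => isOpen_iff_forall_mem_open.2 fun z hz => ?_
  obtain ⟨m, hm⟩ := exists_cylinder_subset hO hz
  exact ⟨_, fun w hw => hm (cylinder_anti _ (le_max_right n m) (loc z m w hw)),
    (isClopen_cylinder z _).isOpen, z.mem_cylinder_self _⟩

/-- `swapFun` as a homeomorphism. -/
noncomputable def swap : B.PathSpace ≃ₜ B.PathSpace where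
  toFun := swapFun x y n h
  invFun := swapFun x y n h
  left_inv := swapFun_swapFun h
  right_inv := swapFun_swapFun h
  continuous_toFun := continuous_swapFun h
  continuous_invFun := continuous_swapFun h

lemma swap_mem {z : B.PathSpace} (hz : z ∈ x.cylinder n) : swap h z ∈ y.cylinder n :=
  swapFun_mem h hz

lemma swap_image_cylinder : swap h '' x.cylinder n = y.cylinder n := by
  refine Subset.antisymm (image_subset_iff.2 fun _ hz => swap_mem h hz) fun z hz => ?_
  exact ⟨swapFun x y n h z, mem_cylinder_iff.2 (initial_swapFun_right h hz), swapFun_swapFun h z⟩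

lemma measurePreserving_swap {μ : Measure B.PathSpace} (hμ : IsTailInvariant μ) :
    MeasurePreserving (swap h) μ μ :=
  hμ (swap h).toMeasurableEquiv fun _ => ⟨n, fun _ hk => (edge_swapFun h hk).symm⟩

end swap

end PathSpace

end StationaryBratteli

namespace StationaryBratteli

variable {V : Type*} [Fintype V] {B : StationaryBratteli V} {μ : Measure B.PathSpace}

open PathSpace

/-! ### The class supporting an ergodic measure -/

lemma mem_vertexClass_self (a : V) : a ∈ B.vertexClass a :=
  ⟨Relation.ReflTransGen.refl, Relation.ReflTransGen.refl⟩

lemma vertexClass_eq {a b : V} (h : b ∈ B.vertexClass a) : B.vertexClass b = B.vertexClass a :=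
  Subset.antisymm (fun _ hv => ⟨h.1.trans hv.1, hv.2.trans h.2⟩)
    fun _ hv => ⟨h.2.trans hv.1, hv.2.trans h.1⟩

/-- The set of vertices reachable from `x.vertex n` decreases with `n`, hence stabilises because `V`
is finite; from then on all vertices of the path reach each other. -/
lemma iUnion_eventualPaths : ⋃ a, B.eventualPaths a = univ := by
  refine eq_univ_of_forall fun x => ?_
  have hanti : Antitone fun n => {v | B.Reaches (x.vertex n) v} :=
    fun m n hmn v hv => (x.reaches_vertex hmn).trans hv
  obtain ⟨N, hN⟩ := WellFoundedLT.antitone_chain_condition (α := Set V) hanti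
  refine mem_iUnion.2 ⟨x.vertex N, N, fun n hn => ⟨x.reaches_vertex hn, ?_⟩⟩
  have h : {v | B.Reaches (x.vertex N) v} = {v | B.Reaches (x.vertex n) v} := hN n hn
  exact (Set.ext_iff.1 h (x.vertex N)).1 Relation.ReflTransGen.refl

lemma eventualPaths_eq_iUnion (a : V) :
    B.eventualPaths a = ⋃ N, ⋂ n ≥ N, {x | x.vertex n ∈ B.vertexClass a} := by
  ext x
  simp [eventualPaths]

lemma measurableSet_eventualPaths (a : V) : MeasurableSet (B.eventualPaths a) := by
  rw [eventualPaths_eq_iUnion]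
  exact .iUnion fun N => .iInter fun n => .iInter fun _ =>
    (isClopen_vertex_mem n _).isClosed.measurableSet

lemma mem_eventualPaths_of_tailRel {a : V} {x y : B.PathSpace} (h : TailRel x y)
    (hx : x ∈ B.eventualPaths a) : y ∈ B.eventualPaths a := by
  obtain ⟨N, hN⟩ := h
  obtain ⟨M, hM⟩ := hx
  refine ⟨max N M, fun n hn => ?_⟩
  rw [← source_edge, ← hN n (le_of_max_le_left hn)]
  exact hM n (le_of_max_le_right hn)

lemma TailRel.symm {x y : B.PathSpace} (h : TailRel x y) : TailRel y x :=
  h.imp fun _ hN n hn => (hN n hn).symm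

lemma exists_mem_supportingClass (herg : IsTailErgodic μ) (h₀ : μ ≠ 0) :
    ∃ a, a ∈ supportingClass μ := by
  by_contra! h
  refine h₀ (Measure.measure_univ_eq_zero.1 ?_)
  rw [← iUnion_eventualPaths]
  exact measure_iUnion_null fun a => (herg _ (measurableSet_eventualPaths a) fun x y hxy =>
    ⟨mem_eventualPaths_of_tailRel hxy, mem_eventualPaths_of_tailRel (TailRel.symm hxy)⟩).resolve_right
      (h a)

/-- Two conull sets of paths meet when `μ ≠ 0`, and a common path has a vertex lying in both
classes. -/
lemma supportingClass_eq (h₀ : μ ≠ 0) {a : V} (ha : a ∈ supportingClass μ) :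
    supportingClass μ = B.vertexClass a := by
  refine Subset.antisymm (fun b hb => ?_) fun b hb => ?_
  · have h : (B.eventualPaths a ∩ B.eventualPaths b).Nonempty := by
      rw [nonempty_iff_ne_empty]
      intro h
      refine h₀ (Measure.measure_univ_eq_zero.1 ?_)
      rw [← compl_empty, ← h, compl_inter]
      exact measure_union_null ha hb
    obtain ⟨x, ⟨N, hN⟩, ⟨M, hM⟩⟩ := h
    have h1 := hN (max N M) (le_max_left _ _)
    have h2 := hM (max N M) (le_max_right _ _)
    rw [← vertexClass_eq h1, vertexClass_eq h2]
    exact mem_vertexClass_self b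
  · have h : B.eventualPaths b = B.eventualPaths a := by
      unfold eventualPaths
      rw [vertexClass_eq hb]
    change μ (B.eventualPaths b)ᶜ = 0
    rw [h]
    exact ha

lemma pow_apply_ne_zero_of_submatrix [DecidableEq V] {S : Set V} [Fintype S] [DecidableEq S]
    {M : Matrix S S ℝ} {F : Matrix V V ℕ} (hM : ∀ u w : S, M u w ≠ 0 → F u w ≠ 0) (k : ℕ)
    (u w : S) (h : (M ^ k) u w ≠ 0) : (F ^ k) u w ≠ 0 := by
  induction k generalizing u w with
  | zero =>
    by_cases huw : u = w
    · simp [huw]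
    · simp [huw] at h
  | succ k ih =>
    rw [pow_succ, Matrix.mul_apply] at h ⊢
    obtain ⟨t, -, ht⟩ := Finset.exists_ne_zero_of_sum_ne_zero h
    exact fun h0 => mul_ne_zero (ih u t (left_ne_zero_of_mul ht))
      (hM t w (right_ne_zero_of_mul ht)) (Finset.sum_eq_zero_iff.1 h0 t (Finset.mem_univ _))

open Classical in
-- The edge from `w` to `u` rules out a zero block. Positivity of a power of the block passes to the
-- same power of `F`, which counts at least the paths inside the class.
lemma exists_pow_pos (hB : B.HasPrimitiveBlocks) {a : V} {u w : V} (hu : u ∈ B.vertexClass a)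
    (hw : w ∈ B.vertexClass a) (huw : 0 < B.F u w) :
    ∃ k > 0, ∀ u ∈ B.vertexClass a, ∀ w ∈ B.vertexClass a, 0 < (B.F ^ k) u w := by
  rcases hB a with h | h
  · have := congr_fun (congr_fun h ⟨u, hu⟩) ⟨w, hw⟩
    simp only [Matrix.zero_apply, Nat.cast_eq_zero] at this
    omega
  · obtain ⟨-, k, hk, hpos⟩ := h
    exact ⟨k, hk, fun u hu w hw => Nat.pos_of_ne_zero (pow_apply_ne_zero_of_submatrix
      (fun u w h => by exact_mod_cast h) k ⟨u, hu⟩ ⟨w, hw⟩ (hpos _ _).ne')⟩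

/-! ### The measures of cylinder sets -/

lemma measure_image_swap (hμ : IsTailInvariant μ) {x y : B.PathSpace} {n : ℕ}
    (h : x.vertex n = y.vertex n) {E : Set B.PathSpace} (hE : MeasurableSet E) :
    μ (swap h '' E) = μ E := by
  have hE' : MeasurableSet (swap h '' E) := (swap h).toMeasurableEquiv.measurableSet_image.2 hE
  rw [← (measurePreserving_swap h hμ).measure_preimage hE'.nullMeasurableSet,
    (swap h).injective.preimage_image]

variable (μ) in
/-- The measure of the cylinder sets that end in the vertex `v` of level `n + 1`. -/
noncomputable def levelMeasure (n : ℕ) (v : V) : ℝ≥0∞ :=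
  μ ((exists_vertex_eq B v n).choose.cylinder n)

lemma measure_cylinder (hμ : IsTailInvariant μ) (x : B.PathSpace) (n : ℕ) :
    μ (x.cylinder n) = levelMeasure μ n (x.vertex n) := by
  have h := (exists_vertex_eq B (x.vertex n) n).choose_spec
  rw [levelMeasure, ← swap_image_cylinder h,
    measure_image_swap hμ h (isClopen_cylinder _ n).isClosed.measurableSet]

lemma sum_edge_eq [DecidableEq V] (v : V) (g : V → ℝ≥0∞) :
    ∑ e : B.Edge, (if e.source = v then g e.range else 0) = ∑ u, (B.F u v : ℝ≥0∞) * g u := by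
  have h : ∑ e : B.Edge, (if e.source = v then g e.range else 0) =
      ∑ e : (Σ p : V × V, Fin (B.F p.1 p.2)), (if e.1.2 = v then g e.1.1 else 0) := rfl
  rw [h, Fintype.sum_sigma, Fintype.sum_prod_type]
  refine Finset.sum_congr rfl fun u _ => ?_
  rw [Finset.sum_eq_single v]
  · simp
  · intro w _ hw
    simp [hw]
  · simp

/-- The entry `(F ^ k) w v` counts the paths of length `k` from `v` to `w`; the induction splits the
cylinder by its next edge. It is needed for `A = univ` and for `A` the supporting class. -/
lemma measure_cylinder_inter [DecidableEq V] (hμ : IsTailInvariant μ) (A : Set V)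
    (x : B.PathSpace) (n k : ℕ) :
    μ (x.cylinder n ∩ {z | z.vertex (n + k) ∈ A}) =
      ∑ w, ((B.F ^ k) w (x.vertex n) : ℝ≥0∞) * A.indicator (levelMeasure μ (n + k)) w := by
  induction k generalizing n x with
  | zero =>
    have h : ∀ z ∈ x.cylinder n, z.vertex (n + 0) = x.vertex n :=
      fun z hz => vertex_eq_of_mem_cylinder hz le_rfl
    rw [Finset.sum_eq_single (x.vertex n) (fun w _ hw => by simp [hw]) (by simp)]
    by_cases hA : x.vertex n ∈ A
    · rw [inter_eq_left.2 fun z hz => show z.vertex (n + 0) ∈ A from (h z hz).symm ▸ hA]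
      simp [hA, measure_cylinder hμ]
    · have : x.cylinder n ∩ {z | z.vertex (n + 0) ∈ A} = ∅ :=
        eq_empty_of_forall_notMem fun z hz => hA (h z hz.1 ▸ hz.2)
      rw [this]
      simp [hA]
  | succ k ih =>
    set E := {z : B.PathSpace | z.vertex (n + (k + 1)) ∈ A} with hE
    have hm : ∀ e, MeasurableSet ((fun z : B.PathSpace => z.edge n) ⁻¹' {e}) :=
      fun e => (isClopen_edge_eq n e).isClosed.measurableSet
    have hsum := sum_measure_preimage_singleton (μ := μ.restrict (x.cylinder n ∩ E))
      (f := fun z : B.PathSpace => z.edge n) Finset.univ fun e _ => hm e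
    rw [Finset.coe_univ, preimage_univ, Measure.restrict_apply_univ] at hsum
    rw [← hsum]
    have hfib : ∀ e, μ.restrict (x.cylinder n ∩ E) ((fun z => z.edge n) ⁻¹' {e}) =
        if e.source = x.vertex n then ∑ w, ((B.F ^ k) w e.range : ℝ≥0∞) *
          A.indicator (levelMeasure μ (n + (k + 1))) w else 0 := by
      intro e
      rw [Measure.restrict_apply (hm e)]
      split_ifs with he
      · obtain ⟨y, hy, rfl⟩ := exists_mem_cylinder_edge_eq x n e he
        rw [y.range_edge, show n + (k + 1) = n + 1 + k by omega, ← ih y (n + 1)]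
        congr 1
        rw [hE, show n + (k + 1) = n + 1 + k by omega, ← inter_assoc]
        congr 1
        rw [← cylinder_eq_of_mem hy]
        ext z
        refine ⟨fun hz => ⟨hz.2.1, fun j hj => ?_⟩,
          fun hz => ⟨hz.2 n n.lt_succ_self, cylinder_anti y n.le_succ hz⟩⟩
        rcases (Nat.lt_succ_iff.1 hj).eq_or_lt with rfl | hj'
        · exact hz.1
        · exact hz.2.2 j hj'
      · refine measure_mono_null (t := ∅) (fun z hz => he ?_) measure_empty
        rw [← hz.1, source_edge, vertex_eq_of_mem_cylinder hz.2.1 le_rfl]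
    simp_rw [hfib]
    rw [sum_edge_eq (x.vertex n) fun u => ∑ w, ((B.F ^ k) w u : ℝ≥0∞) *
          A.indicator (levelMeasure μ (n + (k + 1))) w]
    simp_rw [Finset.mul_sum, pow_succ, Matrix.mul_apply, Nat.cast_sum, Finset.sum_mul]
    rw [Finset.sum_comm]
    refine Finset.sum_congr rfl fun w _ => Finset.sum_congr rfl fun u _ => ?_
    push_cast
    ring

lemma levelMeasure_eq_sum [DecidableEq V] (hμ : IsTailInvariant μ) (n k : ℕ) (v : V) :
    levelMeasure μ n v = ∑ w, ((B.F ^ k) w v : ℝ≥0∞) * levelMeasure μ (n + k) w := by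
  obtain ⟨x, rfl⟩ := exists_vertex_eq B v n
  rw [← measure_cylinder hμ]
  simpa using measure_cylinder_inter hμ univ x n k

lemma levelMeasure_le_of_pos (hμ : IsTailInvariant μ) {n : ℕ} {v w : V} (h : 0 < B.F w v) :
    levelMeasure μ (n + 1) w ≤ levelMeasure μ n v := by
  classical
  rw [levelMeasure_eq_sum hμ n 1 v, pow_one]
  refine le_trans ?_ (Finset.single_le_sum (fun _ _ => zero_le) (Finset.mem_univ w))
  exact le_mul_of_one_le_left zero_le (by exact_mod_cast h)

lemma levelMeasure_eq_zero (hμ : IsTailInvariant μ) {a : V} (ha : a ∈ supportingClass μ) {v : V}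
    (hv : ¬ B.Reaches v a) (n : ℕ) : levelMeasure μ n v = 0 := by
  obtain ⟨x, rfl⟩ := exists_vertex_eq B v n
  rw [← measure_cylinder hμ]
  refine measure_mono_null (t := (B.eventualPaths a)ᶜ) (fun z hz hza => hv ?_) ha
  obtain ⟨N, hN⟩ := hza
  rw [← vertex_eq_of_mem_cylinder hz le_rfl]
  exact (z.reaches_vertex (le_max_left n N)).trans (hN _ (le_max_right n N)).2

/-- Almost every path of a cylinder eventually stays in `α`, so continuity from below recovers its
measure from the vertices of `α` alone. Comparisons between levels inside `α` thereby extend to all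
vertices. -/
lemma levelMeasure_eq_iSup [DecidableEq V] (hμ : IsTailInvariant μ) {a : V}
    (ha : a ∈ supportingClass μ) (n : ℕ) (v : V) :
    levelMeasure μ n v = ⨆ k, ∑ w, ((B.F ^ k) w v : ℝ≥0∞) *
      (B.vertexClass a).indicator (levelMeasure μ (n + k)) w := by
  obtain ⟨x, rfl⟩ := exists_vertex_eq B v n
  simp_rw [← measure_cylinder hμ, ← measure_cylinder_inter hμ]
  refine le_antisymm ?_ (iSup_le fun k => measure_mono inter_subset_left)
  have hmono : Monotone fun k =>
      x.cylinder n ∩ {z | ∀ j ≥ n + k, z.vertex j ∈ B.vertexClass a} := by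
    intro k l hkl z hz
    exact ⟨hz.1, fun j hj => hz.2 j (by omega)⟩
  calc μ (x.cylinder n) ≤ μ ((⋃ k, x.cylinder n ∩
        {z | ∀ j ≥ n + k, z.vertex j ∈ B.vertexClass a}) ∪ (B.eventualPaths a)ᶜ) := by
        refine measure_mono fun z hz => ?_
        by_cases hza : z ∈ B.eventualPaths a
        · obtain ⟨N, hN⟩ := hza
          exact Or.inl (mem_iUnion.2 ⟨N, hz, fun j hj => hN j (by omega)⟩)
        · exact Or.inr hza
    _ ≤ _ := (measure_union_le _ _).trans (by rw [show μ (B.eventualPaths a)ᶜ = 0 from ha, add_zero])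
    _ = ⨆ k, μ (x.cylinder n ∩ {z | ∀ j ≥ n + k, z.vertex j ∈ B.vertexClass a}) :=
        hmono.measure_iUnion
    _ ≤ _ := iSup_mono fun k => measure_mono
        (inter_subset_inter_right _ fun z hz => hz _ le_rfl)

end StationaryBratteli

namespace StationaryBratteli

variable {V : Type*} [Fintype V] {B : StationaryBratteli V} {μ : Measure B.PathSpace}

open PathSpace

lemma F_vertex_pos (x : B.PathSpace) (n : ℕ) : 0 < B.F (x.vertex (n + 1)) (x.vertex n) := by
  have h : 0 < B.F (x.edge n).range (x.edge n).source := (Nat.zero_le _).trans_lt (x.edge n).2.isLt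
  rwa [range_edge, source_edge] at h

lemma reaches_of_pos {v w : V} (h : 0 < B.F w v) : B.Reaches v w := Relation.ReflTransGen.single h

lemma reaches_of_pow_pos [DecidableEq V] {k : ℕ} {v w : V} (h : (B.F ^ k) w v ≠ 0) :
    B.Reaches v w := by
  induction k generalizing v with
  | zero =>
    by_cases hwv : w = v
    · exact hwv ▸ Relation.ReflTransGen.refl
    · simp [hwv] at h
  | succ k ih =>
    rw [pow_succ, Matrix.mul_apply] at h
    obtain ⟨t, -, ht⟩ := Finset.exists_ne_zero_of_sum_ne_zero h
    exact (reaches_of_pos (Nat.pos_of_ne_zero (right_ne_zero_of_mul ht))).trans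
      (ih (left_ne_zero_of_mul ht))

/-! ### Comparison of the measures of cylinder sets on different levels -/

/-- An edge that leaves `α` ends in a vertex that cannot return to it, where cylinders are null. The
sum of all entries of `F` is a crude bound for each of them. -/
lemma levelMeasure_le_sum (hμ : IsTailInvariant μ) {a : V} (ha : a ∈ supportingClass μ) (n : ℕ)
    {v : V} (hv : v ∈ B.vertexClass a) :
    levelMeasure μ n v ≤
      (∑ w, ∑ u, (B.F u w : ℝ≥0∞)) *
        ∑ u, (B.vertexClass a).indicator (levelMeasure μ (n + 1)) u := by
  classical
  rw [levelMeasure_eq_sum hμ n 1 v, pow_one, Finset.mul_sum]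
  refine Finset.sum_le_sum fun u _ => ?_
  by_cases hu : u ∈ B.vertexClass a
  · rw [indicator_of_mem hu]
    gcongr
    exact (Finset.single_le_sum (f := fun u => (B.F u v : ℝ≥0∞)) (fun _ _ => zero_le)
      (Finset.mem_univ u)).trans
      (Finset.single_le_sum (f := fun w => ∑ u, (B.F u w : ℝ≥0∞)) (fun _ _ => zero_le)
      (Finset.mem_univ v))
  · rcases Nat.eq_zero_or_pos (B.F u v) with h | h
    · simp [h]
    · rw [levelMeasure_eq_zero hμ ha (fun hua => hu ⟨hv.1.trans (reaches_of_pos h),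
        hua⟩)]
      simp

/-- The total `s n` over `α` is at most a constant times `s (n + 1)`, while positivity of `F ^ k` on
`α` bounds each single vertex at level index `n` below by `s (n + k)`. Together each vertex is
comparable with the total, uniformly in `n`. -/
lemma exists_comparison (hB : B.HasPrimitiveBlocks) (hμ : IsTailInvariant μ) (h₀ : μ ≠ 0) {a : V}
    (ha : a ∈ supportingClass μ) :
    ∃ C : ℝ≥0∞, C ≠ ∞ ∧ ∀ n, ∀ u ∈ B.vertexClass a, ∀ w ∈ B.vertexClass a,
      levelMeasure μ n u ≤ C * levelMeasure μ n w ∧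
      levelMeasure μ n u ≤ C * levelMeasure μ (n + 1) w ∧
      levelMeasure μ (n + 1) u ≤ C * levelMeasure μ n w := by
  classical
  obtain ⟨k, hk, hpos⟩ : ∃ k > 0, ∀ u ∈ B.vertexClass a, ∀ w ∈ B.vertexClass a,
      0 < (B.F ^ k) u w := by
    have hne : (B.eventualPaths a).Nonempty := by
      rw [nonempty_iff_ne_empty]
      intro h
      refine h₀ (Measure.measure_univ_eq_zero.1 ?_)
      rw [← compl_empty, ← h]
      exact ha
    obtain ⟨x, N, hN⟩ := hne
    exact exists_pow_pos hB (hN _ N.le_succ) (hN _ le_rfl) (F_vertex_pos x N)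
  set s : ℕ → ℝ≥0∞ := fun n => ∑ u, (B.vertexClass a).indicator (levelMeasure μ n) u with hs
  set M : ℝ≥0∞ := ∑ w, ∑ u, (B.F u w : ℝ≥0∞) with hM
  have hMtop : M ≠ ∞ := by simp [hM, ENNReal.sum_eq_top]
  have hle : ∀ n, ∀ w ∈ B.vertexClass a, levelMeasure μ n w ≤ s n := fun n w hw => by
    have := Finset.single_le_sum (f := (B.vertexClass a).indicator (levelMeasure μ n))
      (fun _ _ => zero_le) (Finset.mem_univ w)
    rwa [indicator_of_mem hw] at this
  have hsum : ∀ (n : ℕ) (c : ℝ≥0∞), (∀ w ∈ B.vertexClass a, levelMeasure μ n w ≤ c) →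
      s n ≤ Fintype.card V * c := by
    intro n c hc
    refine (Finset.sum_le_card_nsmul Finset.univ _ c fun w _ => ?_).trans_eq (by simp)
    exact indicator_apply_le' (hc w) fun _ => zero_le
  have hstep : ∀ n, s n ≤ Fintype.card V * M * s (n + 1) := fun n => by
    rw [mul_assoc]
    exact hsum n _ fun w hw => levelMeasure_le_sum hμ ha n hw
  have hpow : ∀ j n, s n ≤ (Fintype.card V * M) ^ j * s (n + j) := by
    intro j
    induction j with
    | zero => simp
    | succ j ih =>
      intro n
      calc s n ≤ (Fintype.card V * M) ^ j * s (n + j) := ih n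
        _ ≤ (Fintype.card V * M) ^ j * (Fintype.card V * M * s (n + j + 1)) := by
          gcongr
          exact hstep _
        _ = _ := by simp only [pow_succ, mul_assoc, add_assoc]
  have hlow : ∀ n, ∀ w ∈ B.vertexClass a, s (n + k) ≤ levelMeasure μ n w := by
    intro n w hw
    rw [levelMeasure_eq_sum hμ n k w]
    refine Finset.sum_le_sum fun u _ => indicator_apply_le' (fun hu => ?_) fun _ => zero_le
    exact le_mul_of_one_le_left zero_le (by exact_mod_cast hpos u hu w hw)
  set q := (Fintype.card V * M) ^ k with hq
  have hCM : (Fintype.card V * M) ≠ ∞ := ENNReal.mul_ne_top (by simp) hMtop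
  have hqtop : q ≠ ∞ := ENNReal.pow_ne_top hCM
  have hup : ∀ n, ∀ w ∈ B.vertexClass a, s n ≤ q * levelMeasure μ n w := fun n w hw =>
    (hpow k n).trans (mul_le_mul_right (hlow n w hw) q)
  -- The last vertex before the return on a closed path at `u` of length `k`.
  have hpred : ∀ u ∈ B.vertexClass a, ∃ t ∈ B.vertexClass a, 0 < B.F u t := by
    intro u hu
    have h := (hpos u hu u hu).ne'
    obtain ⟨j, rfl⟩ := Nat.exists_eq_succ_of_ne_zero hk.ne'
    rw [Nat.succ_eq_add_one, pow_succ', Matrix.mul_apply] at h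
    obtain ⟨t, -, ht⟩ := Finset.exists_ne_zero_of_sum_ne_zero h
    have h1 : 0 < B.F u t := Nat.pos_of_ne_zero (left_ne_zero_of_mul ht)
    exact ⟨t, ⟨hu.1.trans (reaches_of_pow_pos (right_ne_zero_of_mul ht)),
      (reaches_of_pos h1).trans hu.2⟩, h1⟩
  refine ⟨q + Fintype.card V * M * q, ENNReal.add_ne_top.2 ⟨hqtop, ENNReal.mul_ne_top hCM hqtop⟩,
    fun n u hu w hw => ⟨?_, ?_, ?_⟩⟩
  · exact ((hle n u hu).trans (hup n w hw)).trans (mul_le_mul_left le_self_add _)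
  · calc levelMeasure μ n u ≤ s n := hle n u hu
      _ ≤ Fintype.card V * M * s (n + 1) := hstep n
      _ ≤ Fintype.card V * M * (q * levelMeasure μ (n + 1) w) := by
        gcongr
        exact hup _ w hw
      _ ≤ _ := by
        rw [← mul_assoc]
        exact mul_le_mul_left le_add_self _
  · obtain ⟨t, ht, hut⟩ := hpred u hu
    exact (((levelMeasure_le_of_pos hμ hut).trans (hle n t ht)).trans (hup n w hw)).trans
      (mul_le_mul_left le_self_add _)

lemma iff_of_comparison {f : ℕ → ℝ≥0∞} {C : ℝ≥0∞} (hC : C ≠ ∞)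
    (h : ∀ n, f n ≤ C * f (n + 1) ∧ f (n + 1) ≤ C * f n) (m n : ℕ) :
    (f m = 0 ↔ f n = 0) ∧ (f m < ∞ ↔ f n < ∞) := by
  have key : ∀ n, (f n = 0 ↔ f 0 = 0) ∧ (f n < ∞ ↔ f 0 < ∞) := by
    intro n
    induction n with
    | zero => simp
    | succ n ih =>
      refine ⟨Iff.trans ⟨fun h0 => ?_, fun h0 => ?_⟩ ih.1,
        Iff.trans ⟨fun h0 => ?_, fun h0 => ?_⟩ ih.2⟩
      · simpa [h0] using (h n).1
      · simpa [h0] using (h n).2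
      · exact (h n).1.trans_lt (ENNReal.mul_lt_top hC.lt_top h0)
      · exact (h n).2.trans_lt (ENNReal.mul_lt_top hC.lt_top h0)
  exact ⟨(key m).1.trans (key n).1.symm, (key m).2.trans (key n).2.symm⟩

/-- By stationarity the suprema of `levelMeasure_eq_iSup` at two levels have the same coefficients
`F ^ k`, so the constant of `exists_comparison` serves for every vertex. -/
lemma levelMeasure_lt_top_iff (hB : B.HasPrimitiveBlocks) (hμ : IsTailInvariant μ) (h₀ : μ ≠ 0)
    {a : V} (ha : a ∈ supportingClass μ) (v : V) (m n : ℕ) :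
    levelMeasure μ m v < ∞ ↔ levelMeasure μ n v < ∞ := by
  classical
  obtain ⟨C, hC, h⟩ := exists_comparison hB hμ h₀ ha
  have key : ∀ m n, (∀ k, ∀ w ∈ B.vertexClass a,
      levelMeasure μ (m + k) w ≤ C * levelMeasure μ (n + k) w) →
      levelMeasure μ m v ≤ C * levelMeasure μ n v := by
    intro m n hmn
    rw [levelMeasure_eq_iSup hμ ha m v, levelMeasure_eq_iSup hμ ha n v, ENNReal.mul_iSup]
    refine iSup_mono fun k => ?_
    rw [Finset.mul_sum]
    refine Finset.sum_le_sum fun w _ => ?_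
    by_cases hw : w ∈ B.vertexClass a
    · rw [indicator_of_mem hw, indicator_of_mem hw, mul_left_comm]
      gcongr
      exact hmn k w hw
    · simp [hw]
  refine (iff_of_comparison (f := fun n => levelMeasure μ n v) hC
    (fun n => ⟨key _ _ fun k w hw => ?_, key _ _ fun k w hw => ?_⟩) m n).2
  · simpa only [add_right_comm] using (h (n + k) w hw w hw).2.1
  · simpa only [add_right_comm] using (h (n + k) w hw w hw).2.2

lemma exists_cylinder_pos_lt_top (hfin : ∃ U : Set B.PathSpace, IsClopen U ∧ 0 < μ U ∧ μ U < ∞) :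
    ∃ (x : B.PathSpace) (n : ℕ), μ (x.cylinder n) ≠ 0 ∧ μ (x.cylinder n) < ∞ := by
  obtain ⟨U, hU, hpos, hlt⟩ := hfin
  obtain ⟨N, hN⟩ := exists_forall_cylinder_subset hU
  by_contra! h
  refine hpos.ne' (clopen_induction (P := fun R => μ R = 0) measure_empty hN ?_)
  intro x hx R _ _ _ hR
  refine measure_union_null ?_ hR
  by_contra hx0
  exact (h x N hx0).not_gt ((measure_mono (hN x hx)).trans_lt hlt)

/-- A cylinder of positive finite measure contains a non-null cylinder ending in `α`;
`exists_comparison` spreads positivity and finiteness over all of `α` and all levels. -/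
lemma levelMeasure_pos_and_lt_top (hB : B.HasPrimitiveBlocks) (hμ : IsTailInvariant μ)
    (hfin : ∃ U : Set B.PathSpace, IsClopen U ∧ 0 < μ U ∧ μ U < ∞)
    {a : V} (ha : a ∈ supportingClass μ) (n : ℕ) {v : V} (hv : v ∈ B.vertexClass a) :
    levelMeasure μ n v ≠ 0 ∧ levelMeasure μ n v < ∞ := by
  classical
  have h₀ : μ ≠ 0 := by
    rintro rfl
    simp at hfin
  obtain ⟨x, m, hpos, hlt⟩ := exists_cylinder_pos_lt_top hfin
  obtain ⟨C, hC, h⟩ := exists_comparison hB hμ h₀ ha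
  rw [measure_cylinder hμ] at hpos hlt
  have hpos' := hpos
  rw [levelMeasure_eq_iSup hμ ha, Ne, ENNReal.iSup_eq_zero] at hpos'
  push Not at hpos'
  obtain ⟨k, hk⟩ := hpos'
  obtain ⟨w, -, hw⟩ := Finset.exists_ne_zero_of_sum_ne_zero hk
  have hwc : w ∈ B.vertexClass a := by
    by_contra hwc
    simp [hwc] at hw
  rw [indicator_of_mem hwc] at hw
  have hwlt : levelMeasure μ (m + k) w < ∞ := by
    rw [levelMeasure_eq_sum hμ m k] at hlt
    have h1 := (ENNReal.sum_lt_top.1 hlt) w (Finset.mem_univ w)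
    exact ENNReal.lt_top_of_mul_ne_top_right h1.ne (left_ne_zero_of_mul hw)
  have hcomp := iff_of_comparison (f := fun n => levelMeasure μ n w) hC
    (fun n => ⟨(h n w hwc w hwc).2.1, (h n w hwc w hwc).2.2⟩) n (m + k)
  constructor
  · intro h0
    refine right_ne_zero_of_mul hw (hcomp.1.1 ?_)
    simpa [h0] using (h n w hwc v hv).1
  · exact (h n v hv w hwc).1.trans_lt (ENNReal.mul_lt_top hC.lt_top (hcomp.2.2 hwlt))

/-! ### The vertices of `B_f` -/

lemma ne_zero_of_exists_pos (hfin : ∃ U : Set B.PathSpace, IsClopen U ∧ 0 < μ U ∧ μ U < ∞) :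
    μ ≠ 0 := by
  rintro rfl
  simp at hfin

lemma levelMeasure_ne_zero (hB : B.HasPrimitiveBlocks) (hμ : IsTailInvariant μ)
    (hfin : ∃ U : Set B.PathSpace, IsClopen U ∧ 0 < μ U ∧ μ U < ∞)
    {a : V} (ha : a ∈ supportingClass μ) (n : ℕ) {v : V} (hv : B.Reaches v a) :
    levelMeasure μ n v ≠ 0 := by
  induction hv using Relation.ReflTransGen.head_induction_on generalizing n with
  | refl => exact (levelMeasure_pos_and_lt_top hB hμ hfin ha n (mem_vertexClass_self a)).1
  | head h _ ih => exact fun h0 => ih (n + 1) (le_zero_iff.1 (h0 ▸ levelMeasure_le_of_pos hμ h))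

lemma mem_finiteVertices_iff (hB : B.HasPrimitiveBlocks) (hμ : IsTailInvariant μ)
    (hfin : ∃ U : Set B.PathSpace, IsClopen U ∧ 0 < μ U ∧ μ U < ∞)
    {a : V} (ha : a ∈ supportingClass μ) (n : ℕ) {v : V} :
    v ∈ finiteVertices μ ↔ B.Reaches v a ∧ levelMeasure μ n v < ∞ := by
  have h₀ := ne_zero_of_exists_pos hfin
  constructor
  · rintro (hv | ⟨⟨b, hb, hvb⟩, hv⟩)
    · rw [supportingClass_eq h₀ ha] at hv
      exact ⟨hv.2, (levelMeasure_pos_and_lt_top hB hμ hfin ha n hv).2⟩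
    · rw [supportingClass_eq h₀ ha] at hb
      obtain ⟨x, rfl⟩ := exists_vertex_eq B v n
      exact ⟨hvb.trans hb.2, measure_cylinder hμ x n ▸ hv x n rfl⟩
  · rintro ⟨hv, hlt⟩
    -- Vertices of `α` also satisfy the second alternative, so no case distinction is needed.
    refine Or.inr ⟨⟨a, ha, hv⟩, ?_⟩
    rintro x m rfl
    rw [measure_cylinder hμ]
    exact (levelMeasure_lt_top_iff hB hμ h₀ ha _ m n).2 hlt

lemma mem_finiteVertices_of_le (hB : B.HasPrimitiveBlocks) (hμ : IsTailInvariant μ)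
    (hfin : ∃ U : Set B.PathSpace, IsClopen U ∧ 0 < μ U ∧ μ U < ∞)
    {a : V} (ha : a ∈ supportingClass μ) {x : B.PathSpace} {m n : ℕ} (hmn : m ≤ n)
    (hm : x.vertex m ∈ finiteVertices μ) (hn : B.Reaches (x.vertex n) a) :
    x.vertex n ∈ finiteVertices μ := by
  refine (mem_finiteVertices_iff hB hμ hfin ha n).2 ⟨hn, ?_⟩
  rw [← measure_cylinder hμ]
  refine (measure_mono (x.cylinder_anti hmn)).trans_lt ?_
  rw [measure_cylinder hμ]
  exact ((mem_finiteVertices_iff hB hμ hfin ha m).1 hm).2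

lemma vertex_reaches_of_mem_eventualPaths {x : B.PathSpace} {a : V} (hx : x ∈ B.eventualPaths a)
    (n : ℕ) : B.Reaches (x.vertex n) a := by
  obtain ⟨N, hN⟩ := hx
  exact (x.reaches_vertex (le_max_left n N)).trans (hN _ (le_max_right n N)).2

lemma measure_diff_finitePaths (hB : B.HasPrimitiveBlocks) (hμ : IsTailInvariant μ)
    (hfin : ∃ U : Set B.PathSpace, IsClopen U ∧ 0 < μ U ∧ μ U < ∞)
    {a : V} (ha : a ∈ supportingClass μ) :
    μ ({x | x.vertex 0 ∈ finiteVertices μ} \ finitePaths μ) = 0 := by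
  refine measure_mono_null (t := (B.eventualPaths a)ᶜ) (fun x hx hxa => hx.2 fun n => ?_) ha
  exact mem_finiteVertices_of_le hB hμ hfin ha (Nat.zero_le n) hx.1
    (vertex_reaches_of_mem_eventualPaths hxa n)

lemma measure_vertex_mem_finiteVertices_lt_top (hB : B.HasPrimitiveBlocks) (hμ : IsTailInvariant μ)
    (hfin : ∃ U : Set B.PathSpace, IsClopen U ∧ 0 < μ U ∧ μ U < ∞)
    {a : V} (ha : a ∈ supportingClass μ) (n : ℕ) :
    μ {x | x.vertex n ∈ finiteVertices μ} < ∞ := by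
  refine clopen_induction (N := n) (P := fun R => μ R < ∞) (by simp) ?_ ?_
  · intro x hx y hy
    rw [mem_ofPred_eq, vertex_eq_of_mem_cylinder hy le_rfl]
    exact hx
  · intro x hx R _ _ _ hR
    refine measure_union_lt_top ?_ hR
    rw [measure_cylinder hμ]
    exact ((mem_finiteVertices_iff hB hμ hfin ha n).1 hx).2

end StationaryBratteli

/-! ### Clopen sets and null sets -/

/-- `K` and its complement in `Z` are disjoint closed subsets of `X`, and a clopen set separates
them. -/
lemma exists_isClopen_preimage_val_eq {X : Type*} [TopologicalSpace X] [CompactSpace X] [T2Space X] [TotallyDisconnectedSpace X]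
    {Z : Set X} (hZ : IsClosed Z) {K : Set Z} (hK : IsClopen K) :
    ∃ U : Set X, IsClopen U ∧ Subtype.val ⁻¹' U = K := by
  obtain ⟨U, hU, h1, h2⟩ := exists_clopen_of_closed_subset_open
    (hZ.isClosedEmbedding_subtypeVal.isClosedMap K hK.isClosed)
    (hZ.isClosedEmbedding_subtypeVal.isClosedMap Kᶜ hK.compl.isClosed).isOpen_compl
    (fun x hx hx' => by
      obtain ⟨y, hy, rfl⟩ := hx
      obtain ⟨z, hz, hzy⟩ := hx'
      exact hz (Subtype.ext hzy ▸ hy))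
  refine ⟨U, hU, Subset.antisymm (fun y hy => ?_) fun y hy => h1 ⟨y, hy, rfl⟩⟩
  by_contra hyK
  exact h2 hy ⟨y, hyK, rfl⟩

lemma measure_null_union {X : Type*} [MeasurableSpace X] {μ : Measure X} {E R : Set X} (h₀ : μ E = 0) : μ (E ∪ R) = μ R :=
  le_antisymm ((measure_union_le E R).trans_eq (by rw [h₀, zero_add]))
    (measure_mono subset_union_right)

lemma IsClopen.image_homeomorph {X : Type*} [TopologicalSpace X] {f : X ≃ₜ X} {E : Set X} (hE : IsClopen E) : IsClopen (f '' E) :=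
  ⟨f.isClosedMap E hE.isClosed, f.isOpenMap E hE.isOpen⟩

/-! ### Goodness relative to a clopen set -/

section GoodOn

variable {X : Type*} [TopologicalSpace X] [MeasurableSpace X] {μ : Measure X} {T : Set X}

/-- Goodness of `μ` for the clopen subsets of `T`. -/
def IsGoodOn (μ : Measure X) (T : Set X) : Prop :=
  ∀ U V : Set X, IsClopen U → IsClopen V → U ⊆ T → V ⊆ T → μ U < μ V →
    ∃ W : Set X, IsClopen W ∧ W ⊆ V ∧ μ W = μ U

lemma IsGoodOn.mono {T' : Set X} (h : IsGoodOn μ T) (hT : T' ⊆ T) : IsGoodOn μ T' :=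
  fun U V hU hV hUT hVT => h U V hU hV (hUT.trans hT) (hVT.trans hT)

variable [BorelSpace X]

lemma comap_val_preimage {Z : Set X} (hZ : IsClosed Z) (hT : μ (T \ Z) = 0) {U : Set X}
    (hU : U ⊆ T) : μ.comap (Subtype.val : Z → X) (Subtype.val ⁻¹' U) = μ U := by
  rw [(MeasurableEmbedding.subtype_coe hZ.measurableSet).comap_apply, Subtype.image_preimage_coe,
    inter_comm]
  exact measure_inter_conull' (measure_mono_null (sdiff_subset_sdiff_left hU) hT)

/-- Goodness of a multiple of the restriction of `μ` to a closed set which differs from the clopen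
set `T` by a null set. -/
lemma forall_isGoodClopen_comap_iff [CompactSpace X] [T2Space X] [TotallyDisconnectedSpace X]
    {Z : Set X} (hZ : IsClosed Z) (hT : IsClopen T) (hZT : Z ⊆ T) (h₀ : μ (T \ Z) = 0)
    {c : ℝ≥0∞} (hc : c ≠ 0) (hc' : c ≠ ∞) :
    (∀ V, IsClopen V → IsGoodClopen (c • μ.comap (Subtype.val : Z → X)) V) ↔ IsGoodOn μ T := by
  have hval : ∀ U : Set X, U ⊆ T →
      (c • μ.comap (Subtype.val : Z → X)) (Subtype.val ⁻¹' U) = c * μ U := fun U hU => by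
    rw [Measure.smul_apply, smul_eq_mul, comap_val_preimage hZ h₀ hU]
  have hclopen : ∀ K : Set Z, IsClopen K →
      ∃ U : Set X, IsClopen U ∧ U ⊆ T ∧ Subtype.val ⁻¹' U = K := by
    intro K hK
    obtain ⟨U, hU, rfl⟩ := exists_isClopen_preimage_val_eq hZ hK
    refine ⟨U ∩ T, hU.inter hT, inter_subset_right, ?_⟩
    ext z
    simpa using fun _ => hZT z.2
  constructor
  · intro h U V hU hV hUT hVT hlt
    obtain ⟨W', hW', hWV, hWU⟩ := h _ (hV.preimage continuous_subtype_val) _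
      (hU.preimage continuous_subtype_val)
      (by rw [hval U hUT, hval V hVT]; exact ENNReal.mul_lt_mul_right hc hc' hlt)
    obtain ⟨W, hW, hWT, rfl⟩ := hclopen W' hW'
    -- The inclusion in `V` is known only on `Z`; cutting with `V` leaves the trace on `Z`
    -- unchanged.
    refine ⟨W ∩ V, hW.inter hV, inter_subset_right, ?_⟩
    rw [← inter_eq_left.2 hWV, ← preimage_inter, hval _ (inter_subset_right.trans hVT), hval U hUT,
      ENNReal.mul_right_inj hc hc'] at hWU
    exact hWU
  · intro h V' hV' U' hU' hlt
    obtain ⟨V, hV, hVT, rfl⟩ := hclopen V' hV'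
    obtain ⟨U, hU, hUT, rfl⟩ := hclopen U' hU'
    rw [hval U hUT, hval V hVT] at hlt
    obtain ⟨W, hW, hWV, hWU⟩ := h U V hU hV hUT hVT (lt_of_mul_lt_mul_left' hlt)
    exact ⟨Subtype.val ⁻¹' W, hW.preimage continuous_subtype_val, preimage_mono hWV, by
      rw [hval W (hWV.trans hVT), hval U hUT, hWU]⟩

/-- The clopen sets that are finite disjoint unions of clopen null sets and of clopen sets which
some measure preserving homeomorphism maps into `T`. -/
inductive IsUnionOfCopies (μ : Measure X) (T : Set X) : Set X → Prop
  | empty : IsUnionOfCopies μ T ∅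
  | null_union {E R : Set X} (hE : IsClopen E) (h₀ : μ E = 0) (hR : IsUnionOfCopies μ T R) :
      IsUnionOfCopies μ T (E ∪ R)
  | copy_union {E R : Set X} (hE : IsClopen E) (f : X ≃ₜ X) (hf : MeasurePreserving f μ μ)
      (hfT : f '' E ⊆ T) (hER : Disjoint E R) (hR : IsUnionOfCopies μ T R) :
      IsUnionOfCopies μ T (E ∪ R)

lemma Homeomorph.measure_image_of_measurePreserving {f : X ≃ₜ X}
    (hf : MeasurePreserving f μ μ) {E : Set X} (hE : IsClopen E) : μ (f '' E) = μ E := by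
  rw [← hf.measure_preimage (f.isClosedMap E hE.isClosed).measurableSet.nullMeasurableSet,
    f.injective.preimage_image]

lemma measure_diff_isClopen {U W : Set X} (hW : IsClopen W) (h : W ⊆ U) (hU : μ U < ∞) :
    μ (U \ W) = μ U - μ W :=
  measure_sdiff h hW.isClosed.measurableSet.nullMeasurableSet
    ((measure_mono h).trans_lt hU).ne

/-- A union of copies has clopen subsets of the measures of all smaller clopen subsets of `T`. -/
lemma IsGoodOn.exists_subset_of_subset (hgood : IsGoodOn μ T) (hTtop : μ T < ∞) {V : Set X}
    (hV : IsUnionOfCopies μ T V) {U : Set X} (hU : IsClopen U) (hUT : U ⊆ T) (hle : μ U ≤ μ V) :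
    ∃ W, IsClopen W ∧ W ⊆ V ∧ μ W = μ U := by
  induction hV generalizing U with
  | empty => exact ⟨∅, isClopen_empty, Subset.rfl, le_antisymm (by simp) hle⟩
  | null_union hE h₀ hR ih =>
    rw [measure_null_union h₀] at hle
    obtain ⟨W, hW, hWR, hWU⟩ := ih hU hUT hle
    exact ⟨W, hW, hWR.trans subset_union_right, hWU⟩
  | @copy_union E R hE f hf hfT hER hR ih =>
    have hUtop : μ U < ∞ := (measure_mono hUT).trans_lt hTtop
    have hfE : μ (f '' E) = μ E := Homeomorph.measure_image_of_measurePreserving hf hE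
    rw [measure_union' hER hE.isClosed.measurableSet] at hle
    rcases lt_trichotomy (μ U) (μ E) with hlt | heq | hlt
    · obtain ⟨W, hW, hWE, hWU⟩ := hgood U (f '' E) hU (IsClopen.image_homeomorph hE) hUT hfT
        (by rwa [hfE])
      refine ⟨f ⁻¹' W, hW.preimage f.continuous, fun x hx => Or.inl ?_, ?_⟩
      · exact (f.injective.mem_set_image).1 (hWE hx)
      · rw [hf.measure_preimage hW.isClosed.measurableSet.nullMeasurableSet, hWU]
    · exact ⟨E, hE, subset_union_left, heq.symm⟩
    -- Here `E` is too small to hold `U`, so goodness is used the other way round: a part of `U` as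
    -- large as `E` is removed, `E` is used up entirely, and the rest of `U` goes into `R`.
    · obtain ⟨W, hW, hWU, hWE⟩ := hgood (f '' E) U (IsClopen.image_homeomorph hE) hU hfT hUT
        (by rwa [hfE])
      rw [hfE] at hWE
      obtain ⟨W', hW', hWR, hWU'⟩ := ih (U := U \ W) (hU.diff hW) (sdiff_subset.trans hUT) (by
        rw [measure_diff_isClopen hW hWU hUtop, hWE]
        exact tsub_le_iff_left.2 hle)
      refine ⟨E ∪ W', hE.union hW', union_subset_union_right E hWR, ?_⟩
      rw [measure_union' (hER.mono_right hWR) hE.isClosed.measurableSet, hWU',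
        measure_diff_isClopen hW hWU hUtop, hWE, add_tsub_cancel_of_le hlt.le]

/-- The pieces of `U` are moved into `T` and fitted into `V` one at a time. What remains of `V` is
again clopen of finite measure, hence again a union of copies; this is why `hcopies` concerns all
such sets. -/
lemma IsGoodOn.exists_subset_of_isUnionOfCopies (hgood : IsGoodOn μ T) (hTtop : μ T < ∞)
    (hcopies : ∀ V, IsClopen V → μ V < ∞ → IsUnionOfCopies μ T V) {U : Set X}
    (hU : IsUnionOfCopies μ T U) {V : Set X} (hV : IsClopen V) (hVtop : μ V < ∞)
    (hle : μ U ≤ μ V) : ∃ W, IsClopen W ∧ W ⊆ V ∧ μ W = μ U := by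
  induction hU generalizing V with
  | empty => exact ⟨∅, isClopen_empty, empty_subset _, rfl⟩
  | null_union hE h₀ hR ih =>
    rw [measure_null_union h₀] at hle ⊢
    exact ih hV hVtop hle
  | @copy_union E R hE f hf hfT hER hR ih =>
    have hfE : μ (f '' E) = μ E := Homeomorph.measure_image_of_measurePreserving hf hE
    rw [measure_union' hER hE.isClosed.measurableSet] at hle ⊢
    obtain ⟨W, hW, hWV, hWE⟩ := hgood.exists_subset_of_subset hTtop (hcopies V hV hVtop)
      (IsClopen.image_homeomorph hE) hfT (hfE.trans_le (le_self_add.trans hle))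
    rw [hfE] at hWE
    have hWtop : μ W < ∞ := (measure_mono hWV).trans_lt hVtop
    obtain ⟨W', hW', hWV', hWR⟩ := ih (V := V \ W) (hV.diff hW)
      ((measure_mono sdiff_subset).trans_lt hVtop) (by
        rw [measure_diff_isClopen hW hWV hVtop, hWE]
        exact ENNReal.le_sub_of_add_le_left (hWE ▸ hWtop.ne) hle)
    refine ⟨W ∪ W', hW.union hW', union_subset hWV (hWV'.trans sdiff_subset), ?_⟩
    rw [measure_union' (disjoint_sdiff_right.mono_right hWV') hW.isClosed.measurableSet, hWE, hWR]

lemma IsGoodOn.univ_of_copies (hgood : IsGoodOn μ T) (hTtop : μ T < ∞)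
    (hcopies : ∀ V, IsClopen V → μ V < ∞ → IsUnionOfCopies μ T V)
    (happrox : ∀ V, IsClopen V → ∀ r < μ V, ∃ W, IsClopen W ∧ W ⊆ V ∧ r < μ W ∧ μ W < ∞) :
    IsGoodOn μ univ := by
  intro U V hU hV _ _ hlt
  obtain ⟨V', hV', hVV', hlt', hVtop⟩ := happrox V hV _ hlt
  obtain ⟨W, hW, hWV, hWU⟩ := hgood.exists_subset_of_isUnionOfCopies hTtop hcopies
    (hcopies U hU (hlt.trans_le le_top)) hV' hVtop hlt'.le
  exact ⟨W, hW, hWV.trans hVV', hWU⟩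

end GoodOn

/-! ### Moving cylinder sets to the top of `B_f` -/

namespace StationaryBratteli

variable {V : Type*} [Fintype V] {B : StationaryBratteli V} {μ : Measure B.PathSpace}

open PathSpace

/-- The vertices that can be reached at level `n + 1` by paths through `S`. -/
def reachableWithin (B : StationaryBratteli V) (S : Set V) (n : ℕ) : Set V :=
  {v | ∃ y : B.PathSpace, y.vertex n = v ∧ ∀ j ≤ n, y.vertex j ∈ S}

lemma antitone_reachableWithin (S : Set V) : Antitone (B.reachableWithin S) := by
  refine antitone_nat_of_succ_le fun n v hv => ?_
  obtain ⟨y, rfl, hy⟩ := hv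
  refine ⟨y.shift 1, by rw [vertex_shift, add_comm], fun j hj => ?_⟩
  rw [vertex_shift]
  -- By stationarity, dropping the first vertex of a path through `S` gives such a path that is one
  -- step shorter.
  exact hy _ (by omega)

/-- For some `K`, a path that runs through `S` for `K` steps ends in a vertex to which there is a
path through `S` from the top of the diagram. -/
lemma exists_forall_exists_vertex_eq (S : Set V) :
    ∃ K, ∀ (x : B.PathSpace) (n : ℕ), (∀ j, n ≤ j → j ≤ n + K → x.vertex j ∈ S) →
      ∃ y : B.PathSpace, x.vertex (n + K) = y.vertex (n + K) ∧ y.vertex 0 ∈ S := by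
  obtain ⟨K, hK⟩ := WellFoundedLT.antitone_chain_condition (α := Set V)
    (antitone_reachableWithin (B := B) S)
  refine ⟨K, fun x n hx => ?_⟩
  have h : x.vertex (n + K) ∈ B.reachableWithin S K :=
    ⟨x.shift n, rfl, fun j hj => hx (n + j) (by omega) (by omega)⟩
  -- From `K` on the decreasing sets of reachable vertices are constant, so an end reached in `K`
  -- steps is also reached in `n + K` steps.
  rw [hK (n + K) (by omega)] at h
  obtain ⟨y, hy, hyS⟩ := h
  exact ⟨y, hy.symm, hyS 0 (Nat.zero_le _)⟩

/-- Cylinders are taken `K` levels deeper than `U` requires. If the end reaches `α`, the last `K +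
1` vertices are finite, so some path starting in a finite vertex has the same end, and swapping the
two cylinders moves the given one into `T`. Otherwise the cylinder is null. -/
lemma isUnionOfCopies (hB : B.HasPrimitiveBlocks) (hμ : IsTailInvariant μ)
    (hfin : ∃ U : Set B.PathSpace, IsClopen U ∧ 0 < μ U ∧ μ U < ∞)
    {a : V} (ha : a ∈ supportingClass μ) {U : Set B.PathSpace} (hU : IsClopen U) (hUtop : μ U < ∞) :
    IsUnionOfCopies μ {x | x.vertex 0 ∈ finiteVertices μ} U := by
  obtain ⟨N, hN⟩ := exists_forall_cylinder_subset hU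
  obtain ⟨K, hK⟩ := exists_forall_exists_vertex_eq (B := B) (finiteVertices μ)
  refine clopen_induction (N := N + K) .empty
    (fun x hx => (x.cylinder_anti (Nat.le_add_right N K)).trans (hN x hx))
    fun x hx R _ _ hdisj hR => ?_
  by_cases hxa : B.Reaches (x.vertex (N + K)) a
  · have hxN : x.vertex N ∈ finiteVertices μ := by
      refine (mem_finiteVertices_iff hB hμ hfin ha N).2
        ⟨(x.reaches_vertex (Nat.le_add_right N K)).trans hxa, ?_⟩
      rw [← measure_cylinder hμ]
      exact (measure_mono (hN x hx)).trans_lt hUtop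
    obtain ⟨y, hy, hyS⟩ := hK x N fun j hNj hj =>
      mem_finiteVertices_of_le hB hμ hfin ha hNj hxN ((x.reaches_vertex hj).trans hxa)
    refine .copy_union (isClopen_cylinder x _) (swap hy) (measurePreserving_swap hy hμ) ?_ hdisj hR
    rw [swap_image_cylinder]
    intro z hz
    rw [mem_ofPred_eq, vertex_eq_of_mem_cylinder hz (Nat.zero_le _)]
    exact hyS
  · exact .null_union (isClopen_cylinder x _)
      (by rw [measure_cylinder hμ, levelMeasure_eq_zero hμ ha hxa]) hR

/-- Almost every path runs through finite vertices from some level on, and the clopen set of paths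
with a finite vertex at a given level has finite measure. -/
lemma exists_isClopen_subset_lt (hB : B.HasPrimitiveBlocks) (hμ : IsTailInvariant μ)
    (hfin : ∃ U : Set B.PathSpace, IsClopen U ∧ 0 < μ U ∧ μ U < ∞)
    {a : V} (ha : a ∈ supportingClass μ) {U : Set B.PathSpace} (hU : IsClopen U) {r : ℝ≥0∞}
    (hr : r < μ U) : ∃ W, IsClopen W ∧ W ⊆ U ∧ r < μ W ∧ μ W < ∞ := by
  have hmono : Monotone fun n => U ∩ {x | ∀ j ≥ n, x.vertex j ∈ finiteVertices μ} :=
    fun m n hmn => inter_subset_inter_right _ fun x hx j hj => hx j (hmn.trans hj)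
  have hle : μ U ≤ μ (⋃ n, U ∩ {x | ∀ j ≥ n, x.vertex j ∈ finiteVertices μ}) := by
    rw [← measure_null_union (E := (B.eventualPaths a)ᶜ)
      (R := ⋃ n, U ∩ {x | ∀ j ≥ n, x.vertex j ∈ finiteVertices μ}) ha]
    refine measure_mono fun x hx => ?_
    by_cases hxa : x ∈ B.eventualPaths a
    · obtain ⟨N, hN⟩ := hxa
      refine Or.inr (mem_iUnion.2 ⟨N, hx, fun j hj => Or.inl ?_⟩)
      rw [supportingClass_eq (ne_zero_of_exists_pos hfin) ha]
      exact hN j hj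
    · exact Or.inl hxa
  rw [hmono.measure_iUnion] at hle
  obtain ⟨n, hn⟩ := lt_iSup_iff.1 (hr.trans_le hle)
  refine ⟨U ∩ {x | x.vertex n ∈ finiteVertices μ}, hU.inter (isClopen_vertex_mem n _),
    inter_subset_left, hn.trans_le (measure_mono (inter_subset_inter_right _ fun x hx => ?_)),
    (measure_mono inter_subset_right).trans_lt
      (measure_vertex_mem_finiteVertices_lt_top hB hμ hfin ha n)⟩
  exact hx n le_rfl

/-! ### Non-defectiveness of `μ` on its support, fullness of `μ_f`, and the theorem -/

lemma isClosed_finitePaths : IsClosed (finitePaths μ) := by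
  have h : finitePaths μ = ⋂ n, {x : B.PathSpace | x.vertex n ∈ finiteVertices μ} := by
    ext x
    simp [finitePaths, subdiagramPaths]
  rw [h]
  exact isClosed_iInter fun n => (isClopen_vertex_mem n _).isClosed

lemma measure_inter_finitePaths_pos (hB : B.HasPrimitiveBlocks) (hμ : IsTailInvariant μ)
    (hfin : ∃ U : Set B.PathSpace, IsClopen U ∧ 0 < μ U ∧ μ U < ∞)
    {a : V} (ha : a ∈ supportingClass μ) {O : Set B.PathSpace}
    {x : B.PathSpace} {n : ℕ} (hn : x.cylinder n ⊆ O)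
    (hx : x.vertex 0 ∈ finiteVertices μ) (hxa : B.Reaches (x.vertex n) a) :
    0 < μ (O ∩ finitePaths μ) := by
  have hsub : x.cylinder n ⊆ {x | x.vertex 0 ∈ finiteVertices μ} := fun y hy => by
    rw [mem_ofPred_eq, vertex_eq_of_mem_cylinder hy (Nat.zero_le _)]
    exact hx
  calc 0 < μ (x.cylinder n) := by
        rw [measure_cylinder hμ]
        exact pos_iff_ne_zero.2 (levelMeasure_ne_zero hB hμ hfin ha n hxa)
    _ = μ (x.cylinder n ∩ finitePaths μ) :=
        (measure_inter_conull' (measure_mono_null (sdiff_subset_sdiff_left hsub)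
          (measure_diff_finitePaths hB hμ hfin ha))).symm
    _ ≤ _ := measure_mono (inter_subset_inter_left _ hn)

lemma isNonDefective_measureOnSupport (hμ : IsTailInvariant μ) (hB : B.HasPrimitiveBlocks)
    (hatom : ∀ x : B.PathSpace, μ {x} = 0) (hinf : μ univ = ∞)
    (hfin : ∃ U : Set B.PathSpace, IsClopen U ∧ 0 < μ U ∧ μ U < ∞)
    {a : V} (ha : a ∈ supportingClass μ) : IsNonDefective (measureOnSupport μ) := by
  have hemb := MeasurableEmbedding.subtype_coe (μ.isClosed_support.measurableSet)
  have hnull : μ (univ \ μ.support) = 0 := by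
    rw [← compl_eq_univ_sdiff]
    exact Measure.measure_compl_support
  refine ⟨?_, fun x => ?_, ?_, ?_⟩
  · rintro U hU ⟨x, hx⟩
    obtain ⟨O, hO, rfl⟩ := isOpen_induced_iff.1 hU
    rw [measureOnSupport, comap_val_preimage μ.isClosed_support hnull (subset_univ O)]
    exact (Measure.mem_support_iff_forall _).1 x.2 O (hO.mem_nhds hx)
  · rw [measureOnSupport, hemb.comap_apply, image_singleton]
    exact hatom _
  · rw [measureOnSupport, ← preimage_univ,
      comap_val_preimage μ.isClosed_support hnull Subset.rfl, hinf]
  · rw [measureOnSupport, hemb.comap_apply]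
    -- A path that eventually stays in `α` has a cylinder ending in `α` as a neighbourhood of finite
    -- measure, so it is not defective.
    refine measure_mono_null (t := (B.eventualPaths a)ᶜ) ?_ ha
    rintro _ ⟨x, hx, rfl⟩ ⟨N, hN⟩
    have h := hx (Subtype.val ⁻¹' (x : B.PathSpace).cylinder N)
      ((isClopen_cylinder _ N).preimage continuous_subtype_val) (mem_cylinder_self _ N)
    rw [comap_val_preimage μ.isClosed_support hnull (subset_univ _), measure_cylinder hμ] at h
    exact (levelMeasure_pos_and_lt_top hB hμ hfin ha N (hN N le_rfl)).2.ne h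

lemma measure_finitePaths_pos_and_lt_top (hB : B.HasPrimitiveBlocks) (hμ : IsTailInvariant μ)
    (hfin : ∃ U : Set B.PathSpace, IsClopen U ∧ 0 < μ U ∧ μ U < ∞)
    {a : V} (ha : a ∈ supportingClass μ) : μ (finitePaths μ) ≠ 0 ∧ μ (finitePaths μ) ≠ ∞ := by
  constructor
  · obtain ⟨x, hx⟩ := exists_vertex_zero_eq B a
    have := measure_inter_finitePaths_pos hB hμ hfin ha (x := x) (n := 0)
      (subset_univ _) (hx ▸ Or.inl ha) (hx ▸ Relation.ReflTransGen.refl)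
    simpa using this.ne'
  · exact ((measure_mono
      (show finitePaths μ ⊆ {x | x.vertex 0 ∈ finiteVertices μ} from fun x hx => hx 0)).trans_lt
      (measure_vertex_mem_finiteVertices_lt_top hB hμ hfin ha 0)).ne

lemma isFullNonatomicProbability_finiteMeasure (hB : B.HasPrimitiveBlocks) (hμ : IsTailInvariant μ)
    (hatom : ∀ x : B.PathSpace, μ {x} = 0)
    (hfin : ∃ U : Set B.PathSpace, IsClopen U ∧ 0 < μ U ∧ μ U < ∞)
    {a : V} (ha : a ∈ supportingClass μ) : IsFullNonatomicProbability (finiteMeasure μ) := by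
  have hemb := MeasurableEmbedding.subtype_coe (isClosed_finitePaths (μ := μ)).measurableSet
  obtain ⟨h0, htop⟩ := measure_finitePaths_pos_and_lt_top hB hμ hfin ha
  refine ⟨?_, fun x => ?_, ?_⟩
  · rintro U hU ⟨x, hx⟩
    obtain ⟨O, hO, rfl⟩ := isOpen_induced_iff.1 hU
    obtain ⟨n, hn⟩ := exists_cylinder_subset hO hx
    rw [finiteMeasure, Measure.smul_apply, hemb.comap_apply, Subtype.image_preimage_coe, inter_comm,
      smul_eq_mul]
    exact ENNReal.mul_pos (ENNReal.inv_ne_zero.2 htop) (measure_inter_finitePaths_pos hB hμ hfin ha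
      hn (x.2 0) ((mem_finiteVertices_iff hB hμ hfin ha n).1 (x.2 n)).1).ne'
  · rw [finiteMeasure, Measure.smul_apply, hemb.comap_apply, image_singleton, hatom, smul_zero]
  · rw [finiteMeasure, Measure.smul_apply, hemb.comap_apply, image_univ, Subtype.range_coe,
      smul_eq_mul, ENNReal.inv_mul_cancel h0 htop]

end StationaryBratteli

theorem mainTheorem9 {V : Type*} [Fintype V] (B : StationaryBratteli V)
    (hB : B.HasPrimitiveBlocks) (μ : Measure B.PathSpace)
    (hinv : StationaryBratteli.IsTailInvariant μ) (herg : StationaryBratteli.IsTailErgodic μ)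
    (hatom : ∀ x : B.PathSpace, μ {x} = 0) (hinf : μ univ = ∞)
    (hfin : ∃ U : Set B.PathSpace, IsClopen U ∧ 0 < μ U ∧ μ U < ∞) :
    IsGoodInfinite (StationaryBratteli.measureOnSupport μ) ↔
      IsGoodProbability (StationaryBratteli.finiteMeasure μ) := by
  open StationaryBratteli in
  obtain ⟨a, ha⟩ := exists_mem_supportingClass herg (ne_zero_of_exists_pos hfin)
  obtain ⟨h0, htop⟩ := measure_finitePaths_pos_and_lt_top hB hinv hfin ha
  have hnull : μ (univ \ μ.support) = 0 := by
    rw [← compl_eq_univ_sdiff]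
    exact Measure.measure_compl_support
  have h1 : (∀ V, IsClopen V → IsGoodClopen (measureOnSupport μ) V) ↔ IsGoodOn μ univ := by
    rw [← forall_isGoodClopen_comap_iff μ.isClosed_support isClopen_univ (subset_univ _) hnull
      one_ne_zero ENNReal.one_ne_top, one_smul]
    rfl
  have h2 : (∀ V, IsClopen V → IsGoodClopen (finiteMeasure μ) V) ↔
      IsGoodOn μ {x | x.vertex 0 ∈ finiteVertices μ} :=
    forall_isGoodClopen_comap_iff (T := {x : B.PathSpace | x.vertex 0 ∈ finiteVertices μ})
      isClosed_finitePaths (PathSpace.isClopen_vertex_mem 0 _)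
      (fun x hx => hx 0) (measure_diff_finitePaths hB hinv hfin ha) (ENNReal.inv_ne_zero.2 htop)
      (ENNReal.inv_ne_top.2 h0)
  rw [IsGoodInfinite, IsGoodProbability, h1, h2]
  refine ⟨fun h => ⟨isFullNonatomicProbability_finiteMeasure hB hinv hatom hfin ha,
    h.2.mono (subset_univ _)⟩,
    fun h => ⟨isNonDefective_measureOnSupport hinv hB hatom hinf hfin ha, ?_⟩⟩
  exact h.2.univ_of_copies (measure_vertex_mem_finiteVertices_lt_top hB hinv hfin ha 0)
    (fun V hV hVtop => isUnionOfCopies hB hinv hfin ha hV hVtop)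
    fun V hV r hr => exists_isClopen_subset_lt hB hinv hfin ha hV hr
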